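/- Assume Martin's Axiom: no nonempty compact Hausdorff space satisfying the countable chain condition is a union of strictly fewer than $2^{\aleph_0}$ nowhere dense subsets. Let $\Omega$ be a standard Borel space and let $\mathscr C$ be a nonempty family of universally measurable subsets of $\Omega$ (that is, of sets measurable with respect to the completion of every Borel probability measure on $\Omega$). Then the following are equivalent: 1. $\mathscr C$ is distribution-free PAC learnable. 2. The Vapnik--Chervonenkis dimension of $\mathscr C$ (the supremum of the cardinalities of finite sets $s\subseteq\Omega$ such that every subset of $s$ has the form $C\cap s$ with $C\in\mathscr C$) is finite. Here measures are identified with their completions, and $C\cap\sigma$ denotes the labelling in $\{0,1\}^n$ of the points of a sample $\sigma\in\Omega^n$ according to their membership in $C$. Distribution-free PAC learnability means that there is a map $\mathcal L\colon\bigcup_{n}\Omega^n\times\{0,1\}^n\to\mathscr C$ such that, for all $C\in\mathscr C$, all $n$ and all Borel probability measures $\mu$ on $\Omega$, the function $\sigma\mapsto\mu(\mathcal L(\sigma,C\cap\sigma)\bigtriangleup C)$ on $\Omega^n$ is $\mu^{\otimes n}$-measurable, and such that for every $\varepsilon>0$ $$\mu^{\otimes n}\left\{\sigma\in\Omega^n:\mu\big(\mathcal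 L(\sigma,C\cap\sigma)\bigtriangleup C\big)>\varepsilon\right\}\longrightarrow 0\quad\text{as } n\to\infty,$$ uniformly over all $C\in\mathscr C$ and all Borel probability measures $\mu$ on $\Omega$. -/

import Mathlib

open MeasureTheory

namespace PACLearning

/-- The countable chain condition: every family of pairwise disjoint nonempty open sets is
countable. -/
def CountableChainCondition (X : Type*) [TopologicalSpace X] : Prop :=
  ∀ 𝒰 : Set (Set X), (∀ U ∈ 𝒰, IsOpen U ∧ U.Nonempty) → 𝒰.PairwiseDisjoint id → 𝒰.Countable

/-- Martin's Axiom: no nonempty compact Hausdorff space with the countable chain condition is a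
union of strictly less than continuum many nowhere dense subsets. -/
def MartinsAxiom : Prop :=
  ∀ (X : Type) [TopologicalSpace X] [CompactSpace X] [T2Space X] [Nonempty X],
    CountableChainCondition X →
      ∀ 𝒩 : Set (Set X), Cardinal.mk 𝒩 < Cardinal.continuum →
        (∀ N ∈ 𝒩, IsNowhereDense N) → ⋃₀ 𝒩 ≠ Set.univ

section

variable {Ω : Type*}

/-- The class `𝒞` shatters the finite set `s`: every subset of `s` is cut out by some concept. -/
def Shatters (𝒞 : Set (Set Ω)) (s : Finset Ω) : Prop :=
  ∀ t : Set Ω, t ⊆ ↑s → ∃ C ∈ 𝒞, C ∩ ↑s = t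

/-- The Vapnik-Chervonenkis dimension: the supremum of the cardinalities of the finite shattered
sets, with value `⊤` if these are unbounded. -/
noncomputable def vcDim (𝒞 : Set (Set Ω)) : ℕ∞ :=
  ⨆ (s : Finset Ω) (_ : Shatters 𝒞 s), (s.card : ℕ∞)

open Classical in
/-- The labelling of the points of the sample `σ` by the concept `C`, which encodes `C ∩ σ`. -/
noncomputable def labels (C : Set Ω) {n : ℕ} (σ : Fin n → Ω) : Fin n → Bool :=
  fun i => decide (σ i ∈ C)

variable [MeasurableSpace Ω]

/-- Universal measurability: measurability for the completion of every probability measure. -/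
def UniversallyMeasurable (A : Set Ω) : Prop :=
  ∀ μ : ProbabilityMeasure Ω, NullMeasurableSet A (μ : Measure Ω)

/-- The product measure `μ^{⊗n}` on `Ω^n`. -/
noncomputable def samplingMeasure (μ : ProbabilityMeasure Ω) (n : ℕ) : Measure (Fin n → Ω) :=
  Measure.pi fun _ => (μ : Measure Ω)

/-- A learning rule for `𝒞` under a family `ℳ` of probability measures: a map from labelled
samples to `𝒞` such that, for every `C ∈ 𝒞`, every `n` and every `μ ∈ ℳ`, the error
`σ ↦ μ (L (σ, C ∩ σ) ∆ C)` is a measurable function on `Ω^n` for the completion of `μ^{⊗n}`.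
(The value at the empty sample, `n = 0`, is irrelevant.) -/
structure LearningRule (𝒞 : Set (Set Ω)) (ℳ : Set (ProbabilityMeasure Ω)) where
  /-- the hypothesis chosen on the sample `σ` with labels `τ` -/
  rule : ∀ {n : ℕ}, (Fin n → Ω) → (Fin n → Bool) → Set Ω
  /-- the hypothesis belongs to the class -/
  rule_mem : ∀ {n : ℕ} (σ : Fin n → Ω) (τ : Fin n → Bool), rule σ τ ∈ 𝒞
  /-- the error is a measurable function of the sample -/
  measurable_error : ∀ C ∈ 𝒞, ∀ n : ℕ, ∀ μ ∈ ℳ,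
    NullMeasurable
      (fun σ : Fin n → Ω => (μ : Measure Ω).real (symmDiff (rule σ (labels C σ)) C))
      (samplingMeasure μ n)

/-- The learning rule `L` is probably approximately correct under `ℳ`: for every `ε > 0`,
`μ^{⊗n} {σ | μ (L (σ, C ∩ σ) ∆ C) > ε} → 0` as `n → ∞`, uniformly over `C ∈ 𝒞` and `μ ∈ ℳ`. -/
def LearningRule.IsPAC {𝒞 : Set (Set Ω)} {ℳ : Set (ProbabilityMeasure Ω)}
    (L : LearningRule 𝒞 ℳ) : Prop :=
  ∀ ε : ℝ, 0 < ε → ∀ δ : ℝ, 0 < δ → ∃ N : ℕ, ∀ n : ℕ, N ≤ n → ∀ C ∈ 𝒞, ∀ μ ∈ ℳ,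
    (samplingMeasure μ n).real
      {σ : Fin n → Ω | ε < (μ : Measure Ω).real (symmDiff (L.rule σ (labels C σ)) C)} ≤ δ

/-- `𝒞` is PAC learnable under `ℳ`. -/
def PACLearnable (𝒞 : Set (Set Ω)) (ℳ : Set (ProbabilityMeasure Ω)) : Prop :=
  ∃ L : LearningRule 𝒞 ℳ, L.IsPAC

/-- Distribution-free PAC learnability: PAC learnability under all probability measures. -/
def DistributionFreePACLearnable (𝒞 : Set (Set Ω)) : Prop :=
  PACLearnable 𝒞 Set.univ

end

end PACLearning

/-!
The argument has four parts.

*Martin's Axiom and null sets.* Martin's Axiom makes the ideal of null sets of a finite Borel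
measure on a standard Borel space closed under unions of fewer than continuum many sets
(`MartinsAxiom.measure_iUnion_null`). Given null sets `N i`, cover each by open sets `U (i, k)` of
measure less than `1 / (k + 1)`, and look at the sets `S` of pairs `(i, k)` all of whose finite
subunions have measure at most `r`. They form a closed subspace of a Cantor cube; it satisfies the
countable chain condition because the measure algebra is separable and the cube carries a product
measure that charges every cylinder. If `r` avoids the fewer than continuum many measures of finite
unions, then for each `i` the sets `S` that contain some `(i, k)` form a dense open set. A point in
all of these yields an open set of measure at most `r` that contains every `N i`. Consequently a
union of fewer than continuum many null measurable sets is almost everywhere equal to a countable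
subunion (`MartinsAxiom.exists_countable_ae_iUnion`).

*ε-nets.* For a finite family of sets of measure at least `ε` whose traces have VC dimension at most
`d`, the probability that an `n`-sample misses one of them is bounded by a quantity that tends to
`0` and depends on `d`, `ε` and `n` only (`measure_disjoint_sample_le`): double the sample, swap at
random, and count traces by the Sauer-Shelah lemma.

*The learning rule.* There are only continuum many probability measures on `Ω`, and each `L¹(μ)` is
separable, so the class contains a family `D w`, indexed by the initial ordinal of the continuum,
that is dense in the class for every `μ` simultaneously. This family replaces the class, which may
have more than continuum many members. The rule returns the first `D w` consistent with the sample.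
Almost every sample labelled by `C` is labelled in the same way by one of countably many
`D (w k)` that approximate `C` (`exists_seq_ae_agree`), so that the hypothesis lies in one of
countably many proper initial segments. These have fewer than continuum many members, and Martin's Axiom gives
both the measurability of the error and the reduction of the error bound to countable, hence finite,
families, where the ε-net bound applies (`distributionFreePACLearnable_of_card_le`).

*The converse* is the no-free-lunch argument and needs no set theory: against the uniform measure on
a shattered set of `2 * n` points, any rule that sees `n` points errs on average over all labellings
with probability at least `1 / 4` (`exists_card_le_of_distributionFreePACLearnable`).
-/

namespace PACLearning

/-! ### A combinatorial form of Martin's Axiom -/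

section MartinsAxiom

open Set

/-- Martin's Axiom for a poset of finite conditions: `Good` is a downward closed family of finite
subsets of `J` that is a countable union of linked pieces (the fibres of `c`), and every condition
can be extended into each `T i` by an element outside any prescribed finite set. Then some set,
all of whose finite subsets are conditions, meets every `T i`. The compact space is that of all
sets whose finite subsets are conditions, as a subspace of `J → Bool`. -/
theorem MartinsAxiom.exists_generic (hMA : MartinsAxiom) {J ι K : Type} [Countable K]
    (Good : Finset J → Prop) (h_empty : Good ∅)
    (h_mono : ∀ a b : Finset J, a ⊆ b → Good b → Good a)
    (c : Finset J → K)
    (h_linked : ∀ a b : Finset J, Good a → Good b → c a = c b → ∃ d, Good d ∧ a ⊆ d ∧ b ⊆ d)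
    (hι : Cardinal.mk ι < Cardinal.continuum) (T : ι → Set J)
    (hT : ∀ i a, Good a → ∀ F : Finset J, ∃ j ∈ T i, j ∉ F ∧ ∃ d, Good d ∧ j ∈ d ∧ a ⊆ d) :
    ∃ S : Set J, (∀ a : Finset J, ↑a ⊆ S → Good a) ∧ ∀ i, (S ∩ T i).Nonempty := by
  classical
  let X : Set (J → Bool) := {S | ∀ a : Finset J, (∀ j ∈ a, S j = true) → Good a}
  have hXc : IsClosed X := by
    have : X = ⋂ a : Finset J, {S : J → Bool | (∀ j ∈ a, S j = true) → Good a} := by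
      ext S; simp [X]
    rw [this]
    refine isClosed_iInter fun a => ?_
    by_cases ha : Good a
    · simp [ha]
    · simp only [ha, imp_false]
      have : {S : J → Bool | ¬ ∀ j ∈ a, S j = true} = ⋃ j ∈ a, {S | S j = false} := by
        ext S; simp
      rw [this]
      exact isClosed_biUnion_finset fun j _ => isClosed_eq (continuous_apply j) continuous_const
  have hmemX : ∀ a : Finset J, Good a → (fun j => decide (j ∈ a)) ∈ X := by
    intro a ha b hb
    exact h_mono b a (fun j hj => by simpa using hb j hj) ha
  have : CompactSpace X := isCompact_iff_compactSpace.mp hXc.isCompact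
  have : Nonempty X := ⟨⟨_, hmemX ∅ h_empty⟩⟩
  -- every point of an open set has a basic neighbourhood given by finitely many coordinates
  have hbasic : ∀ V : Set X, IsOpen V → ∀ x ∈ V, ∃ F : Finset J,
      ∀ y : X, (∀ j ∈ F, y.1 j = x.1 j) → y ∈ V := by
    rintro V hV x hx
    obtain ⟨W, hW, rfl⟩ := isOpen_induced_iff.mp hV
    obtain ⟨F, u, hu, hF⟩ := isOpen_pi_iff.mp hW x.1 hx
    refine ⟨F, fun y hy => hF fun j hj => ?_⟩
    rw [hy j hj]
    exact (hu j hj).2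
  have hccc : CountableChainCondition X := by
    intro 𝒰 h𝒰 hdisj
    choose! x hx using fun V (hV : V ∈ 𝒰) => (h𝒰 V hV).2
    choose! F hF using fun V (hV : V ∈ 𝒰) => hbasic V (h𝒰 V hV).1 (x V) (hx V hV)
    let a : Set X → Finset J := fun V => (F V).filter fun j => (x V).1 j = true
    have ha : ∀ V, Good (a V) := fun V => (x V).2 _ fun j hj => (Finset.mem_filter.mp hj).2
    have hcover : 𝒰 = ⋃ k : K, {V ∈ 𝒰 | c (a V) = k} := by ext V; simp
    rw [hcover]
    refine countable_iUnion fun k => ?_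
    -- within a linked piece, disjoint open sets contain the traces of disjoint cylinders of the
    -- cube, and these have positive measure for the fair coin-tossing measure
    let ν : Measure (J → Bool) :=
      Measure.infinitePi fun _ => (PMF.uniformOfFintype Bool).toMeasure
    let Z : Set X → Set (J → Bool) := fun V => (F V : Set J).pi fun j => {(x V).1 j}
    have hZm : ∀ V, MeasurableSet (Z V) := fun V =>
      MeasurableSet.pi (F V).countable_toSet fun j _ => measurableSet_singleton _
    have hZpos : ∀ V, 0 < ν (Z V) := by
      intro V
      rw [show ν (Z V) = _ from
        Measure.infinitePi_pi _ fun j _ => measurableSet_singleton _]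
      refine pos_iff_ne_zero.mpr (Finset.prod_ne_zero_iff.mpr fun j _ => ?_)
      rw [PMF.toMeasure_apply_singleton _ _ (measurableSet_singleton _)]
      simp
    have hZdisj : ∀ V ∈ 𝒰, ∀ V' ∈ 𝒰, c (a V) = c (a V') → V ≠ V' → Disjoint (Z V) (Z V') := by
      intro V hV V' hV' hcc hne
      rw [Set.disjoint_left]
      intro S hS hS'
      obtain ⟨d, hd, had, had'⟩ := h_linked _ _ (ha V) (ha V') hcc
      -- the union of the two conditions, as a point of the space, lies in both open sets: as the
      -- cylinders meet, it violates no negative requirement of either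
      have hg : Good (a V ∪ a V') := h_mono _ d (Finset.union_subset had had') hd
      have hS : ∀ j ∈ F V, S j = (x V).1 j := fun j hj => by simpa using hS j hj
      have hS' : ∀ j ∈ F V', S j = (x V').1 j := fun j hj => by simpa using hS' j hj
      refine Set.disjoint_left.mp (hdisj hV hV' hne)
        (hF V hV ⟨_, hmemX _ hg⟩ fun j hj => ?_) (hF V' hV' ⟨_, hmemX _ hg⟩ fun j hj => ?_)
      · have := hS j hj
        have := hS' j
        simp only [a, Finset.mem_union, Finset.mem_filter]
        grind
      · have := hS' j hj
        have := hS j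
        simp only [a, Finset.mem_union, Finset.mem_filter]
        grind
    have := Measure.countable_meas_pos_of_disjoint_iUnion (μ := ν)
      (As := fun V : {V ∈ 𝒰 | c (a V) = k} => Z V) (fun V => hZm _)
      (fun V V' hne => hZdisj _ V.2.1 _ V'.2.1 (V.2.2.trans V'.2.2.symm)
        fun h => hne (Subtype.ext h))
    have huniv : {V : {V ∈ 𝒰 | c (a V) = k} | 0 < ν (Z V)} = univ := by
      ext V; simp [hZpos]
    rw [huniv, countable_univ_iff] at this
    exact this
  let D : ι → Set X := fun i => {x | ∃ j ∈ T i, x.1 j = true}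
  have hDo : ∀ i, IsOpen (D i) := by
    intro i
    have : D i = ⋃ j ∈ T i, {x : X | x.1 j = true} := by ext x; simp [D]
    rw [this]
    refine isOpen_biUnion fun j _ => ?_
    have hc : Continuous fun x : X => x.1 j := (continuous_apply j).comp continuous_subtype_val
    exact (isOpen_discrete {true}).preimage hc
  have hDd : ∀ i, Dense (D i) := by
    intro i
    rw [dense_iff_inter_open]
    rintro V hV ⟨x, hx⟩
    obtain ⟨F, hF⟩ := hbasic V hV x hx
    have ha : Good (F.filter fun j => x.1 j = true) := x.2 _ fun j hj => (Finset.mem_filter.mp hj).2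
    obtain ⟨j, hj, hjF, d, hd, hjd, had⟩ := hT i _ ha F
    have hg : Good (insert j (F.filter fun j => x.1 j = true)) :=
      h_mono _ d (Finset.insert_subset hjd had) hd
    refine ⟨⟨_, hmemX _ hg⟩, hF _ fun l hl => ?_, j, hj, by simp⟩
    have : l ≠ j := fun h => hjF (h ▸ hl)
    by_cases h : x.1 l = true <;> simp_all
  have hne := hMA X hccc (range fun i => (D i)ᶜ) (Cardinal.mk_range_le.trans_lt hι) (by
    rintro _ ⟨i, rfl⟩
    rw [IsNowhereDense, (hDo i).isClosed_compl.closure_eq]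
    exact interior_eq_empty_iff_dense_compl.mpr (by rw [compl_compl]; exact hDd i))
  obtain ⟨x, hx⟩ := (ne_univ_iff_exists_notMem _).mp hne
  refine ⟨{j | x.1 j = true}, fun a ha => x.2 a fun j hj => ha hj, fun i => ?_⟩
  have : x ∈ D i := by
    by_contra h
    exact hx ⟨_, ⟨i, rfl⟩, h⟩
  obtain ⟨j, hj, hxj⟩ := this
  exact ⟨j, hxj, hj⟩

end MartinsAxiom

/-! ### Additivity of measure under Martin's Axiom -/

section Additivity

open Set

/-- Continuity from below along finite subunions; the sets need not be measurable. -/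
theorem measure_biUnion_le_of_forall_finset {α ι : Type*} [MeasurableSpace α] {μ : Measure α}
    {f : ι → Set α} {T : Set ι} (hT : T.Countable) {c : ENNReal}
    (h : ∀ a : Finset ι, ↑a ⊆ T → μ (⋃ i ∈ a, f i) ≤ c) : μ (⋃ i ∈ T, f i) ≤ c := by
  classical
  have := hT.to_subtype
  have heq : ⋃ i ∈ T, f i = ⋃ a : Finset T, ⋃ i ∈ a, f i := by
    ext x
    simp only [mem_iUnion, exists_prop]
    constructor
    · rintro ⟨i, hi, hx⟩
      exact ⟨{⟨i, hi⟩}, ⟨i, hi⟩, by simp, hx⟩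
    · rintro ⟨a, i, -, hx⟩
      exact ⟨i, i.2, hx⟩
  have hmono : Monotone fun a : Finset T => ⋃ i ∈ a, f i := fun a b hab =>
    biUnion_subset_biUnion_left hab
  rw [heq, hmono.directed_le.measure_iUnion]
  refine iSup_le fun a => ?_
  refine le_trans (measure_mono ?_) (h (a.image Subtype.val) (by simp))
  intro x
  simp

/-- The real line comes first because Martin's Axiom speaks of spaces in `Type`. -/
theorem MartinsAxiom.measure_iUnion_null_real (hMA : MartinsAxiom) (μ : Measure ℝ)
    [IsFiniteMeasure μ] {ι : Type} (N : ι → Set ℝ)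
    (hι : Cardinal.mk ι < Cardinal.continuum) (hN : ∀ i, μ (N i) = 0) :
    μ (⋃ i, N i) = 0 := by
  classical
  refine le_antisymm (ENNReal.le_of_forall_pos_le_add fun ε hε _ => ?_) bot_le
  rw [zero_add]
  have hU : ∀ j : ι × ℕ, ∃ U, U ⊇ N j.1 ∧ IsOpen U ∧ μ U < ENNReal.ofReal (1 / (j.2 + 1)) :=
    fun j => (N j.1).exists_isOpen_lt_of_lt _ (by
      rw [hN]; exact ENNReal.ofReal_pos.mpr (by positivity))
  choose U hNU hUo hUμ using hU
  let m : Finset (ι × ℕ) → ℝ := fun a => μ.real (⋃ j ∈ a, U j)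
  have hm_mono : ∀ a b, a ⊆ b → m a ≤ m b := fun a b hab =>
    measureReal_mono (biUnion_subset_biUnion_left hab) (measure_ne_top _ _)
  have hmeas : ∀ a : Finset (ι × ℕ), MeasurableSet (⋃ j ∈ a, U j) := fun a =>
    Finset.measurableSet_biUnion a fun j _ => (hUo j).measurableSet
  -- a bound that no finite union attains, so that a condition within the bound leaves room for
  -- further sets; it exists because there are fewer than continuum many finite unions
  obtain ⟨r, hr, hrm⟩ : ∃ r ∈ Ioo (0 : ℝ) ε, r ∉ range m := by
    by_contra! hcon
    have h1 : Cardinal.mk (Ioo (0 : ℝ) ε) ≤ Cardinal.mk (range m) :=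
      Cardinal.mk_le_mk_of_subset hcon
    rw [Cardinal.mk_Ioo_real (by exact_mod_cast hε)] at h1
    have hJ : Cardinal.mk (ι × ℕ) < Cardinal.continuum := by
      rw [Cardinal.mk_prod]
      simpa using Cardinal.mul_lt_of_lt Cardinal.aleph0_le_continuum hι Cardinal.aleph0_lt_continuum
    have hfin : Cardinal.mk (Finset (ι × ℕ)) < Cardinal.continuum := by
      rcases finite_or_infinite (ι × ℕ) with h | h
      · exact (Cardinal.lt_aleph0_of_finite _).trans Cardinal.aleph0_lt_continuum
      · rwa [Cardinal.mk_finset_of_infinite]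
    exact (h1.trans Cardinal.mk_range_le).not_gt hfin
  have hlt : ∀ a, m a ≤ r → m a < r := fun a ha => lt_of_le_of_ne ha fun h => hrm ⟨a, h⟩
  obtain ⟨𝒜, h𝒜c, h𝒜⟩ := exists_countable_measureDense μ
  have := h𝒜c.to_subtype
  have happ : ∀ a, ∃ t : 𝒜, m a ≤ r → μ.real (symmDiff (⋃ j ∈ a, U j) t) < (r - m a) / 2 := by
    intro a
    by_cases ha : m a ≤ r
    · obtain ⟨t, ht, h⟩ := h𝒜.approx _ (hmeas a) (measure_ne_top _ _) ((r - m a) / 2)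
        (by linarith [hlt a ha])
      exact ⟨⟨t, ht⟩, fun _ => (ENNReal.lt_ofReal_iff_toReal_lt (measure_ne_top _ _)).mp h⟩
    · exact ⟨⟨_, h𝒜.nonempty.some_mem⟩, fun h => absurd h ha⟩
  -- two conditions approximated by the same member of the countable family are compatible
  choose c hc using happ
  obtain ⟨S, hS, hST⟩ := hMA.exists_generic (J := ι × ℕ) (fun a => m a ≤ r)
    (by simpa [m] using hr.1.le) (fun a b hab hb => (hm_mono a b hab).trans hb) c
    (by
      intro a b ha hb hab
      refine ⟨a ∪ b, ?_, Finset.subset_union_left, Finset.subset_union_right⟩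
      have hca := hc a ha
      have hcb := hc b hb
      rw [← hab] at hcb
      have hun : m (a ∪ b) = μ.real ((⋃ j ∈ a, U j) ∪ ⋃ j ∈ b, U j) := by
        simp only [m, Finset.set_biUnion_union]
      have key : ∀ A B t : Set ℝ,
          μ.real (A ∪ B) ≤ μ.real A + (μ.real (symmDiff A t) + μ.real (symmDiff B t)) := by
        intro A B t
        have : A ∪ B ⊆ A ∪ (symmDiff A t ∪ symmDiff B t) := by
          intro x; simp only [mem_union, mem_symmDiff]; tauto
        exact (measureReal_mono this).trans ((measureReal_union_le _ _).trans
          (by gcongr; exact measureReal_union_le _ _))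
      have h1 := key (⋃ j ∈ a, U j) (⋃ j ∈ b, U j) (c a)
      have h2 := key (⋃ j ∈ b, U j) (⋃ j ∈ a, U j) (c a)
      rw [union_comm] at h2
      change m (a ∪ b) ≤ r
      rw [hun]
      change _ ≤ m a + _ at h1
      change _ ≤ m b + _ at h2
      linarith)
    hι (fun i => {j | j.1 = i})
    (by
      intro i a ha F
      have hpos : 0 < r - m a := by linarith [hlt a ha]
      obtain ⟨k₀, hk₀⟩ := exists_nat_one_div_lt hpos
      obtain ⟨k, hk, hkF⟩ := ((Ici_infinite k₀).sdiff (F.image Prod.snd).finite_toSet).nonempty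
      refine ⟨(i, k), rfl, fun h => hkF (by simpa using ⟨i, h⟩), insert (i, k) a, ?_,
        Finset.mem_insert_self _ _, Finset.subset_insert _ _⟩
      have h1 : m (insert (i, k) a) ≤ μ.real (U (i, k)) + m a := by
        simp only [m, Finset.set_biUnion_insert]
        exact measureReal_union_le _ _
      have h2 : μ.real (U (i, k)) < 1 / (k + 1) :=
        (ENNReal.lt_ofReal_iff_toReal_lt (measure_ne_top _ _)).mp (hUμ (i, k))
      have h3 : (1 : ℝ) / (k + 1) ≤ 1 / (k₀ + 1) := by
        have : (k₀ : ℝ) ≤ k := by exact_mod_cast hk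
        gcongr
      linarith)
  have hsub : ⋃ i, N i ⊆ ⋃ j ∈ S, U j := by
    refine iUnion_subset fun i => ?_
    obtain ⟨j, hjS, rfl⟩ := hST i
    exact (hNU j).trans (subset_biUnion_of_mem (u := U) hjS)
  obtain ⟨T, hTS, hTc, hT⟩ := TopologicalSpace.isOpen_biUnion_countable S U fun j _ => hUo j
  refine (measure_mono hsub).trans ?_
  rw [← hT]
  refine measure_biUnion_le_of_forall_finset hTc fun a ha => ?_
  have h1 : m a ≤ ε := (hS a (ha.trans hTS)).trans hr.2.le
  have := (ENNReal.le_ofReal_iff_toReal_le (measure_ne_top _ _) (by positivity)).mpr h1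
  simpa using this

theorem MartinsAxiom.measure_iUnion_null (hMA : MartinsAxiom) {Y : Type*} [MeasurableSpace Y]
    [StandardBorelSpace Y] (ν : Measure Y) [IsFiniteMeasure ν] {ι : Type} (N : ι → Set Y)
    (hι : Cardinal.mk ι < Cardinal.continuum) (hN : ∀ i, ν (N i) = 0) :
    ν (⋃ i, N i) = 0 := by
  have hf := measurableEmbedding_embeddingReal Y
  have key : ∀ s : Set Y, ν.map (embeddingReal Y) (embeddingReal Y '' s) = ν s := fun s => by
    rw [hf.map_apply, hf.injective.preimage_image]
  rw [← key, image_iUnion]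
  exact hMA.measure_iUnion_null_real _ _ hι fun i => by rw [key, hN]

/-- A union of fewer than continuum many null measurable sets is almost everywhere equal to one of
its countable subunions, namely one of maximal measure. -/
theorem MartinsAxiom.exists_countable_ae_iUnion (hMA : MartinsAxiom) {Y : Type*}
    [MeasurableSpace Y] [StandardBorelSpace Y] (ν : Measure Y) [IsFiniteMeasure ν] {ι : Type}
    (A : ι → Set Y) (hι : Cardinal.mk ι < Cardinal.continuum)
    (hA : ∀ i, NullMeasurableSet (A i) ν) :
    ∃ T : Set ι, T.Countable ∧ (⋃ i, A i) =ᵐ[ν] ⋃ i ∈ T, A i := by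
  -- a countable subunion of maximal measure
  let 𝒯 : Set (Set ι) := {T | T.Countable}
  obtain ⟨u, -, hu, huT⟩ := exists_seq_tendsto_sSup
    (S := (fun T : Set ι => ν (⋃ i ∈ T, A i)) '' 𝒯)
    ⟨_, ∅, countable_empty, rfl⟩ (OrderTop.bddAbove _)
  choose t ht htu using huT
  have hTc : (⋃ n, t n).Countable := countable_iUnion ht
  refine ⟨⋃ n, t n, hTc, ?_⟩
  have hmax : ∀ T' : Set ι, T'.Countable → ν (⋃ i ∈ T', A i) ≤ ν (⋃ i ∈ ⋃ n, t n, A i) := by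
    intro T' hT'
    refine le_trans (b := sSup ((fun T : Set ι => ν (⋃ i ∈ T, A i)) '' 𝒯))
      (le_sSup ⟨T', hT', rfl⟩) ?_
    refine le_of_tendsto' hu fun n => ?_
    rw [← htu]
    exact measure_mono (biUnion_subset_biUnion_left (subset_iUnion t n))
  have hnm : NullMeasurableSet (⋃ i ∈ ⋃ n, t n, A i) ν :=
    NullMeasurableSet.biUnion hTc fun i _ => hA i
  have hdiff : ∀ i, ν (A i \ ⋃ i ∈ ⋃ n, t n, A i) = 0 := by
    intro i
    have h := hmax (insert i (⋃ n, t n)) (hTc.insert i)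
    rw [biUnion_insert, union_comm, ← measure_add_sdiff hnm] at h
    simpa using (ENNReal.le_sub_of_add_le_left (measure_ne_top _ _) h)
  have hnull : ν ((⋃ i, A i) \ ⋃ i ∈ ⋃ n, t n, A i) = 0 := by
    rw [iUnion_sdiff]
    exact hMA.measure_iUnion_null ν _ hι hdiff
  exact (ae_le_set.mpr hnull).antisymm
    (LE.le.eventuallyLE (iUnion₂_subset_iUnion _ _))

theorem MartinsAxiom.nullMeasurableSet_iUnion (hMA : MartinsAxiom) {Y : Type*}
    [MeasurableSpace Y] [StandardBorelSpace Y] {ν : Measure Y} [IsFiniteMeasure ν] {ι : Type}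
    {A : ι → Set Y} (hι : Cardinal.mk ι < Cardinal.continuum)
    (hA : ∀ i, NullMeasurableSet (A i) ν) : NullMeasurableSet (⋃ i, A i) ν := by
  obtain ⟨T, hT, h⟩ := hMA.exists_countable_ae_iUnion ν A hι hA
  exact (NullMeasurableSet.biUnion hT fun i _ => hA i).congr h.symm

end Additivity

/-! ### Counting traces and swaps -/

section EpsilonNet

open Finset

/-- The Sauer-Shelah bound for the traces of a family of sets on a tuple of points, repetitions
allowed. -/
theorem card_image_trace_le {Ω α ι : Type*} [Fintype α] [DecidableEq α] (z : α → Ω)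
    (H : ι → Set Ω) (F : Finset ι) [∀ i a, Decidable (z a ∈ H i)] {d : ℕ}
    (hVC : ∀ s : Finset Ω, (∀ t : Set Ω, t ⊆ ↑s → ∃ i ∈ F, H i ∩ ↑s = t) → s.card ≤ d) :
    (F.image fun i => univ.filter fun a => z a ∈ H i).card
      ≤ ∑ k ∈ Iic d, (Fintype.card α).choose k := by
  classical
  set 𝒯 := F.image fun i => univ.filter fun a => z a ∈ H i
  refine (card_le_card_shatterer 𝒯).trans (card_shatterer_le_sum_vcDim.trans ?_)
  have hd : 𝒯.vcDim ≤ d := by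
    refine Finset.sup_le fun u hu => ?_
    rw [mem_shatterer] at hu
    -- a shattered set of indices is mapped injectively onto a shattered set of points
    have hinj : Set.InjOn z u := by
      intro a ha b hb hab
      obtain ⟨v, hv, huv⟩ := hu (singleton_subset_iff.mpr ha)
      obtain ⟨i, -, rfl⟩ := mem_image.mp hv
      have h1 : a ∈ u ∩ univ.filter (fun a => z a ∈ H i) := by rw [huv]; simp
      have h2 : b ∈ u ∩ univ.filter (fun a => z a ∈ H i) := by
        simp only [mem_inter, mem_filter, mem_univ, true_and] at h1 ⊢
        exact ⟨hb, hab ▸ h1.2⟩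
      rw [huv, mem_singleton] at h2
      exact h2.symm
    rw [← card_image_of_injOn hinj]
    refine hVC _ fun t ht => ?_
    obtain ⟨v, hv, huv⟩ := hu (filter_subset (fun a => z a ∈ t) u)
    obtain ⟨i, hi, rfl⟩ := mem_image.mp hv
    refine ⟨i, hi, ?_⟩
    have key : ∀ a ∈ u, (z a ∈ H i ↔ z a ∈ t) := fun a ha => by
      have := Finset.ext_iff.mp huv a
      simpa [ha] using this
    ext x
    constructor
    · rintro ⟨hx, hxu⟩
      obtain ⟨a, ha, rfl⟩ := mem_image.mp (mem_coe.mp hxu)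
      exact (key a ha).mp hx
    · intro hx
      obtain ⟨a, ha, rfl⟩ := mem_image.mp (mem_coe.mp (ht hx))
      exact ⟨(key a ha).mpr hx, ht hx⟩
  exact sum_le_sum_of_subset (Iic_subset_Iic.mpr hd)

/-- The pairs `(j, false)` and `(j, true)` are the two points in position `j` of a double sample,
`t` is the trace of a set on it, and `s` chooses which point of each position goes to the first
half. If the first half misses `t` while the second hits it at least `k` times, then `s` is forced
in at least `k` positions. -/
theorem card_swaps_mul_two_pow_le {n : ℕ} (t : Finset (Fin n × Bool)) (k : ℕ) :
    (univ.filter fun s : Fin n → Bool => (∀ j, (j, s j) ∉ t) ∧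
      k ≤ (univ.filter fun j => (j, !s j) ∈ t).card).card * 2 ^ k ≤ 2 ^ n := by
  set 𝒮 := univ.filter fun s : Fin n → Bool => (∀ j, (j, s j) ∉ t) ∧
      k ≤ (univ.filter fun j => (j, !s j) ∈ t).card
  rcases 𝒮.eq_empty_or_nonempty with h | ⟨s₀, hs₀⟩
  · simp [h]
  obtain ⟨-, hs₀k⟩ := (mem_filter.mp hs₀).2
  set J := univ.filter fun j => (j, !s₀ j) ∈ t
  have hsub : 𝒮 ⊆ Fintype.piFinset fun j => if j ∈ J then {s₀ j} else univ := by
    intro s hs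
    rw [Fintype.mem_piFinset]
    intro j
    by_cases hj : j ∈ J
    · have h1 := (mem_filter.mp hs).2.1 j
      have h2 := (mem_filter.mp hj).2
      have h3 : s j ≠ !s₀ j := fun h => h1 (h ▸ h2)
      simpa [hj] using h3
    · simp [hj]
  have hcard : (Fintype.piFinset fun j => if j ∈ J then {s₀ j} else univ).card
      = 2 ^ (n - J.card) := by
    rw [Fintype.card_piFinset]
    have : ∀ j, (if j ∈ J then {s₀ j} else univ : Finset Bool).card = if j ∈ J then 1 else 2 := by
      intro j; split_ifs <;> simp
    simp only [this]
    rw [Finset.prod_ite]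
    simp [Finset.filter_not, Finset.card_sdiff]
  have hJ : J.card ≤ n := (card_le_univ J).trans_eq (Fintype.card_fin n)
  calc 𝒮.card * 2 ^ k ≤ 2 ^ (n - J.card) * 2 ^ J.card := by
        rw [← hcard]
        exact Nat.mul_le_mul (card_le_card hsub) (Nat.pow_le_pow_right two_pos hs₀k)
    _ = 2 ^ n := by rw [← pow_add, Nat.sub_add_cancel hJ]

end EpsilonNet

/-! ### The ε-net bound -/

section EpsilonNet

open Finset

variable {Ω ι : Type*} [MeasurableSpace Ω]

open Classical in
/-- The event that some member of the family `H i`, `i ∈ F`, misses the first half of a double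
sample and contains at least `k` points of the second half. A double sample is encoded as `n` pairs
of points, so that swapping within pairs acts coordinatewise. -/
def ghostEvent (H : ι → Set Ω) (F : Finset ι) (n k : ℕ) : Set (Fin n → Ω × Ω) :=
  {z | ∃ i ∈ F, (∀ j, (z j).1 ∉ H i) ∧ k ≤ (univ.filter fun j => (z j).2 ∈ H i).card}

open Classical in
theorem measurableSet_le_card_hits {A : Set Ω} (hA : MeasurableSet A) (n k : ℕ) :
    MeasurableSet {σ : Fin n → Ω | k ≤ (univ.filter fun j => σ j ∈ A).card} := by
  simp only [card_filter]
  refine measurableSet_le measurable_const (Finset.measurable_sum _ fun j _ => ?_)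
  exact Measurable.ite (measurable_pi_apply j hA) measurable_const measurable_const

theorem measurableSet_ghostEvent {H : ι → Set Ω} {F : Finset ι}
    (hH : ∀ i ∈ F, MeasurableSet (H i)) (n k : ℕ) : MeasurableSet (ghostEvent H F n k) := by
  classical
  have : ghostEvent H F n k = ⋃ i ∈ F, ((⋂ j, {z | (z j).1 ∉ H i}) ∩
      (fun z j => (z j).2) ⁻¹' {σ : Fin n → Ω | k ≤ (univ.filter fun j => σ j ∈ H i).card}) := by
    ext z; simp [ghostEvent]; tauto
  rw [this]
  refine Finset.measurableSet_biUnion _ fun i hi => ?_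
  refine (MeasurableSet.iInter fun j => ?_).inter
    ((measurableSet_le_card_hits (hH i hi) n k).preimage (by fun_prop))
  exact ((hH i hi).preimage (by fun_prop : Measurable fun z : Fin n → Ω × Ω => (z j).1)).compl

/-- Symmetrization: the measure is invariant under the `2 ^ n` swaps, and for each double sample a
trace is compatible with at most `2 ^ (n - k)` of them. -/
theorem measure_ghostEvent_mul_two_pow_le (μ : Measure Ω) [IsProbabilityMeasure μ]
    {H : ι → Set Ω} {F : Finset ι} (hH : ∀ i ∈ F, MeasurableSet (H i)) {d : ℕ}
    (hVC : ∀ s : Finset Ω, (∀ t : Set Ω, t ⊆ ↑s → ∃ i ∈ F, H i ∩ ↑s = t) → s.card ≤ d)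
    (n k : ℕ) :
    (Measure.pi fun _ : Fin n => μ.prod μ) (ghostEvent H F n k) * 2 ^ k
      ≤ (∑ l ∈ Iic d, (2 * n).choose l : ℕ) := by
  classical
  set ρ := Measure.pi fun _ : Fin n => μ.prod μ
  set B := ghostEvent H F n k
  set G := ∑ l ∈ Iic d, (2 * n).choose l
  have hB : MeasurableSet B := measurableSet_ghostEvent hH n k
  let coord : (Fin n → Ω × Ω) → Fin n × Bool → Ω := fun z p => bif p.2 then (z p.1).2 else (z p.1).1
  let φ : (Fin n → Bool) → (Fin n → Ω × Ω) → Fin n → Ω × Ω := fun s z j =>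
    (bif s j then Prod.swap else id) (z j)
  have hφ : ∀ s, MeasurePreserving (φ s) ρ ρ := by
    intro s
    refine measurePreserving_pi _ _ (f := fun j => bif s j then Prod.swap else id) fun j => ?_
    cases s j
    · exact MeasurePreserving.id _
    · exact Measure.measurePreserving_swap
  have hφ1 : ∀ s z j, (φ s z j).1 = coord z (j, s j) := by
    intro s z j; simp only [φ, coord]; cases s j <;> rfl
  have hφ2 : ∀ s z j, (φ s z j).2 = coord z (j, !s j) := by
    intro s z j; simp only [φ, coord]; cases s j <;> rfl
  have hcount : ∀ z, (univ.filter fun s => φ s z ∈ B).card * 2 ^ k ≤ G * 2 ^ n := by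
    intro z
    set 𝒯 := F.image fun i => univ.filter fun p => coord z p ∈ H i
    have h𝒯 : 𝒯.card ≤ G := by
      have := card_image_trace_le (coord z) H F hVC
      simpa [mul_comm n 2] using this
    have hsub : (univ.filter fun s => φ s z ∈ B) ⊆ 𝒯.biUnion fun t =>
        univ.filter fun s : Fin n → Bool => (∀ j, (j, s j) ∉ t) ∧
          k ≤ (univ.filter fun j => (j, !s j) ∈ t).card := by
      intro s hs
      obtain ⟨i, hi, h1, h2⟩ := (mem_filter.mp hs).2
      refine mem_biUnion.mpr ⟨_, mem_image_of_mem _ hi, ?_⟩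
      simp only [hφ1, hφ2] at h1 h2
      simpa using ⟨h1, h2⟩
    calc _ ≤ (∑ t ∈ 𝒯, (univ.filter fun s : Fin n → Bool => (∀ j, (j, s j) ∉ t) ∧
          k ≤ (univ.filter fun j => (j, !s j) ∈ t).card).card) * 2 ^ k :=
          Nat.mul_le_mul_right _ ((card_le_card hsub).trans card_biUnion_le)
      _ ≤ ∑ t ∈ 𝒯, 2 ^ n := by
          rw [sum_mul]
          exact sum_le_sum fun t _ => card_swaps_mul_two_pow_le t k
      _ ≤ G * 2 ^ n := by
          rw [sum_const, smul_eq_mul]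
          exact Nat.mul_le_mul_right _ h𝒯
  -- averaging over all swaps
  have havg : (2 : ENNReal) ^ n * ρ B =
      ∫⁻ z, ((univ.filter fun s => φ s z ∈ B).card : ENNReal) ∂ρ := by
    have h1 : ∀ z, ((univ.filter fun s => φ s z ∈ B).card : ENNReal)
        = ∑ s, (φ s ⁻¹' B).indicator 1 z := by
      intro z
      simp [Set.indicator_apply]
    simp only [h1]
    rw [lintegral_finsetSum _ fun s _ => measurable_one.indicator (hB.preimage (hφ s).measurable)]
    simp only [lintegral_indicator_one (hB.preimage (hφ _).measurable),
      (hφ _).measure_preimage hB.nullMeasurableSet]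
    simp
  have hfinal : (2 : ENNReal) ^ n * (ρ B * 2 ^ k) ≤ 2 ^ n * G := by
    rw [← mul_assoc, havg, ← lintegral_mul_const' _ _ (by simp)]
    refine (lintegral_mono (g := fun _ => (2 : ENNReal) ^ n * G) fun z => ?_).trans (by simp)
    have := hcount z
    rw [mul_comm G] at this
    dsimp only
    exact_mod_cast this
  exact (ENNReal.mul_le_mul_iff_right (by simp) (by simp)).mp hfinal

open Classical in
/-- A reverse Markov inequality: the fraction of sample points in `A` has mean at least `ε` and is
at most `1`. -/
theorem half_le_measure_le_card_hits (μ : Measure Ω) [IsProbabilityMeasure μ] {A : Set Ω}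
    (hA : MeasurableSet A) {ε : ℝ} (hε : 0 ≤ ε) (hμA : ε ≤ μ.real A) {n : ℕ} (hn : 0 < n) :
    ε / 2 ≤ (Measure.pi fun _ : Fin n => μ).real
      {σ | ⌈ε / 2 * n⌉₊ ≤ (univ.filter fun j => σ j ∈ A).card} := by
  set ν := Measure.pi fun _ : Fin n => μ
  set E : Set (Fin n → Ω) := {σ | ⌈ε / 2 * n⌉₊ ≤ (univ.filter fun j => σ j ∈ A).card}
  have hE : MeasurableSet E := measurableSet_le_card_hits hA n _
  have hpre : ∀ j : Fin n, MeasurableSet (Function.eval j ⁻¹' A : Set (Fin n → Ω)) :=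
    fun j => measurable_pi_apply j hA
  have hmean : ∫ σ, ∑ j, (Function.eval j ⁻¹' A : Set (Fin n → Ω)).indicator (fun _ => (1 : ℝ)) σ ∂ν
      = n * μ.real A := by
    rw [integral_finsetSum _ fun j _ => (integrable_const (1 : ℝ)).indicator (hpre j)]
    simp only [integral_indicator_const _ (hpre _)]
    simp [
      (measurePreserving_eval (fun _ : Fin n => μ) _).measureReal_preimage hA.nullMeasurableSet, ν]
  have hle : ∀ σ, ∑ j, (Function.eval j ⁻¹' A : Set (Fin n → Ω)).indicator (fun _ => (1 : ℝ)) σ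
      ≤ E.indicator (fun _ => (n : ℝ)) σ + ε / 2 * n := by
    intro σ
    have hc : ∑ j, (Function.eval j ⁻¹' A : Set (Fin n → Ω)).indicator (fun _ => (1 : ℝ)) σ
        = ((univ.filter fun j => σ j ∈ A).card : ℝ) := by
      simp [Set.indicator_apply]
    rw [hc]
    by_cases hσ : σ ∈ E
    · rw [Set.indicator_of_mem hσ]
      have : (univ.filter fun j => σ j ∈ A).card ≤ n := by
        simpa using card_le_univ (univ.filter fun j => σ j ∈ A)
      have : ((univ.filter fun j => σ j ∈ A).card : ℝ) ≤ n := by exact_mod_cast this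
      have : 0 ≤ ε / 2 * n := by positivity
      linarith
    · rw [Set.indicator_of_notMem hσ, zero_add]
      have := not_le.mp (show ¬ ⌈ε / 2 * n⌉₊ ≤ _ from hσ)
      exact (Nat.lt_ceil.mp this).le
  have hint := integral_mono (μ := ν)
    (integrable_finsetSum _ fun j _ => (integrable_const (1 : ℝ)).indicator (hpre j))
    (((integrable_const (n : ℝ)).indicator hE).add (integrable_const (ε / 2 * n))) hle
  rw [hmean, integral_add' ((integrable_const (n : ℝ)).indicator hE) (integrable_const _),
    integral_indicator_const _ hE, integral_const] at hint
  simp only [probReal_univ, smul_eq_mul, one_mul] at hint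
  have hn' : (0 : ℝ) < n := by exact_mod_cast hn
  have h1 : n * ε ≤ n * μ.real A := by gcongr
  have h2 : n * (ε / 2) ≤ n * ν.real E := by linarith
  exact le_of_mul_le_mul_left h2 hn'

/-- If the first half misses `H i`, then the independent second half hits it at least `ε / 2 * n`
times with probability at least `ε / 2`. -/
theorem measure_disjoint_sample_mul_le_ghostEvent (μ : Measure Ω) [IsProbabilityMeasure μ]
    {H : ι → Set Ω} {F : Finset ι} (hH : ∀ i ∈ F, MeasurableSet (H i)) {ε : ℝ} (hε : 0 ≤ ε)
    (hμH : ∀ i ∈ F, ε ≤ μ.real (H i)) {n : ℕ} (hn : 0 < n) :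
    ENNReal.ofReal (ε / 2) *
        (Measure.pi fun _ : Fin n => μ) (⋃ i ∈ F, {σ | ∀ j, σ j ∉ H i})
      ≤ (Measure.pi fun _ : Fin n => μ.prod μ) (ghostEvent H F n ⌈ε / 2 * n⌉₊) := by
  classical
  set k := ⌈ε / 2 * n⌉₊
  set ν := Measure.pi fun _ : Fin n => μ
  have hpres := measurePreserving_arrowProdEquivProdArrow Ω Ω (Fin n) (fun _ => μ) fun _ => μ
  let e := MeasurableEquiv.arrowProdEquivProdArrow Ω Ω (Fin n)
  let B' : Set ((Fin n → Ω) × (Fin n → Ω)) := e.symm ⁻¹' ghostEvent H F n k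
  have hB' : MeasurableSet B' := e.symm.measurable (measurableSet_ghostEvent hH n k)
  have heq : ghostEvent H F n k = e ⁻¹' B' := by
    ext z; simp [B']
  have hA : MeasurableSet (⋃ i ∈ F, {σ : Fin n → Ω | ∀ j, σ j ∉ H i}) := by
    refine Finset.measurableSet_biUnion _ fun i hi => ?_
    simp only [Set.ofPred_forall]
    exact MeasurableSet.iInter fun j => (measurable_pi_apply j (hH i hi)).compl
  rw [heq, hpres.measure_preimage hB'.nullMeasurableSet, Measure.prod_apply hB',
    ← lintegral_indicator_const hA]
  refine lintegral_mono fun σ => ?_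
  by_cases hσ : σ ∈ ⋃ i ∈ F, {σ : Fin n → Ω | ∀ j, σ j ∉ H i}
  · rw [Set.indicator_of_mem hσ]
    obtain ⟨i, hi, hσi⟩ := Set.mem_iUnion₂.mp hσ
    have hhalf := half_le_measure_le_card_hits μ (hH i hi) hε (hμH i hi) hn
    refine (ENNReal.ofReal_le_of_le_toReal hhalf).trans (measure_mono fun σ' hσ' => ?_)
    exact ⟨i, hi, hσi, hσ'⟩
  · rw [Set.indicator_of_notMem hσ]
    exact zero_le

/-- The ε-net bound for a finite family of null measurable sets. The VC hypothesis is about actual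
traces, not traces up to null sets, so the sets are made measurable by removing one common null
set. -/
theorem measure_disjoint_sample_le (μ : Measure Ω) [IsProbabilityMeasure μ]
    {H : ι → Set Ω} {F : Finset ι} (hH : ∀ i ∈ F, NullMeasurableSet (H i) μ) {d : ℕ}
    (hVC : ∀ s : Finset Ω, (∀ t : Set Ω, t ⊆ ↑s → ∃ i ∈ F, H i ∩ ↑s = t) → s.card ≤ d)
    {ε : ℝ} (hε : 0 < ε) (hμH : ∀ i ∈ F, ε ≤ μ.real (H i)) {n : ℕ} (hn : 0 < n) :
    (Measure.pi fun _ : Fin n => μ) (⋃ i ∈ F, {σ | ∀ j, σ j ∉ H i})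
      ≤ ENNReal.ofReal (2 / ε * ((∑ l ∈ Iic d, (2 * n).choose l : ℕ) / 2 ^ ⌈ε / 2 * n⌉₊)) := by
  classical
  -- outside a null set all members of the finite family are measurable
  choose! K hKH hKm hKae using fun i (hi : i ∈ F) => (hH i hi).exists_measurable_subset_ae_eq
  let Z : Set Ω := toMeasurable μ (⋃ i ∈ F, H i \ K i)
  have hZ : μ Z = 0 := by
    rw [measure_toMeasurable]
    exact (measure_biUnion_null_iff F.countable_toSet).mpr fun i hi =>
      ae_le_set.mp (hKae i hi).symm.le
  have hdiff : ∀ i ∈ F, H i \ Z = K i \ Z := by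
    intro i hi
    refine Set.Subset.antisymm (fun x hx => ⟨?_, hx.2⟩) fun x hx => ⟨hKH i hi hx.1, hx.2⟩
    by_contra hxK
    exact hx.2 (subset_toMeasurable μ _ (Set.mem_biUnion (mem_coe.mpr hi) ⟨hx.1, hxK⟩))
  have hm : ∀ i ∈ F, MeasurableSet (H i \ Z) := fun i hi => by
    rw [hdiff i hi]; exact (hKm i hi).diff (measurableSet_toMeasurable _ _)
  have hμ : ∀ i ∈ F, ε ≤ μ.real (H i \ Z) := fun i hi => by
    rw [measureReal_def, measure_sdiff_null hZ]; exact hμH i hi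
  have hVC' : ∀ s : Finset Ω, (∀ t : Set Ω, t ⊆ ↑s → ∃ i ∈ F, (H i \ Z) ∩ ↑s = t) → s.card ≤ d := by
    intro s hs
    refine hVC s fun t ht => ?_
    obtain ⟨i₀, -, hi₀⟩ := hs s subset_rfl
    obtain ⟨i, hi, rfl⟩ := hs t ht
    refine ⟨i, hi, ?_⟩
    ext x
    have : x ∈ s → x ∉ Z := fun hx => (hi₀.symm.subset hx).1.2
    simp only [Set.mem_inter_iff, Set.mem_sdiff, mem_coe]
    tauto
  set k := ⌈ε / 2 * n⌉₊
  have h1 := measure_disjoint_sample_mul_le_ghostEvent μ hm hε.le hμ hn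
  have h2 := measure_ghostEvent_mul_two_pow_le μ hm hVC' n k
  have h3 : (⋃ i ∈ F, {σ : Fin n → Ω | ∀ j, σ j ∉ H i})
      ⊆ ⋃ i ∈ F, {σ : Fin n → Ω | ∀ j, σ j ∉ H i \ Z} :=
    Set.iUnion₂_mono fun i _ σ hσ j hj => hσ j hj.1
  refine (measure_mono h3).trans ?_
  have h4 := (mul_le_mul_left h1 (2 ^ k)).trans h2
  have h5 := ENNReal.toReal_mono (by simp) h4
  rw [ENNReal.toReal_mul, ENNReal.toReal_mul, ENNReal.toReal_ofReal (by positivity)] at h5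
  simp only [ENNReal.toReal_pow, ENNReal.toReal_ofNat, ENNReal.toReal_natCast] at h5
  refine (ENNReal.le_ofReal_iff_toReal_le (measure_ne_top _ _) (by positivity)).mpr ?_
  rw [div_mul_div_comm, le_div_iff₀ (by positivity)]
  linarith

theorem tendsto_sum_choose_div_two_pow (d : ℕ) {ε : ℝ} (hε : 0 < ε) :
    Filter.Tendsto (fun n : ℕ =>
      2 / ε * ((∑ l ∈ Iic d, (2 * n).choose l : ℕ) / (2 : ℝ) ^ ⌈ε / 2 * n⌉₊))
      Filter.atTop (nhds 0) := by
  set r : ℝ := (2 : ℝ) ^ (-(ε / 2))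
  have hr0 : 0 ≤ r := by positivity
  have hr1 : r < 1 := Real.rpow_lt_one_of_one_lt_of_neg one_lt_two (by linarith)
  have hlim := (tendsto_pow_const_mul_const_pow_of_lt_one d hr0 hr1).const_mul
    (2 / ε * ((d + 1) * 2 ^ d))
  rw [mul_zero] at hlim
  refine squeeze_zero' (Filter.Eventually.of_forall fun n => by positivity) ?_ hlim
  filter_upwards [Filter.eventually_ge_atTop 1] with n hn
  have h1 : ((∑ l ∈ Iic d, (2 * n).choose l : ℕ) : ℝ) ≤ (d + 1) * (2 * n) ^ d := by
    have : ∑ l ∈ Iic d, (2 * n).choose l ≤ ∑ l ∈ Iic d, (2 * n) ^ d :=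
      sum_le_sum fun l hl => (Nat.choose_le_pow _ _).trans
        (Nat.pow_le_pow_right (by omega) (mem_Iic.mp hl))
    rw [sum_const, Nat.card_Iic, smul_eq_mul] at this
    exact_mod_cast this
  have h2 : ((2 : ℝ) ^ ⌈ε / 2 * n⌉₊)⁻¹ ≤ r ^ n := by
    rw [← Real.rpow_natCast, ← Real.rpow_natCast, ← Real.rpow_mul zero_le_two,
      ← Real.rpow_neg zero_le_two]
    refine Real.rpow_le_rpow_of_exponent_le one_le_two ?_
    have := Nat.le_ceil (ε / 2 * n)
    linarith
  calc 2 / ε * (((∑ l ∈ Iic d, (2 * n).choose l : ℕ) : ℝ) / (2 : ℝ) ^ ⌈ε / 2 * n⌉₊)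
      ≤ 2 / ε * (((d + 1) * (2 * n) ^ d) * r ^ n) := by
        refine mul_le_mul_of_nonneg_left ?_ (by positivity)
        rw [div_eq_mul_inv]
        gcongr
    _ = _ := by ring

end EpsilonNet

/-! ### A dense subfamily indexed by the continuum -/

section DenseFamily

open Set

/-- Any family of null measurable sets is separable for the distance `μ (C ∆ D)`. -/
theorem exists_seq_dense_in_measure {Ω : Type*} [MeasurableSpace Ω]
    [MeasurableSpace.CountablyGenerated Ω] (μ : Measure Ω) [IsFiniteMeasure μ]
    {𝒞 : Set (Set Ω)} (h𝒞 : 𝒞.Nonempty) (hmeas : ∀ C ∈ 𝒞, NullMeasurableSet C μ) :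
    ∃ g : ℕ → Set Ω, (∀ k, g k ∈ 𝒞) ∧
      ∀ C ∈ 𝒞, ∀ ε : ℝ, 0 < ε → ∃ k, μ.real (symmDiff (g k) C) < ε := by
  classical
  obtain ⟨𝒜, h𝒜c, h𝒜⟩ := exists_countable_measureDense μ
  obtain ⟨a, ha⟩ := h𝒜c.exists_eq_range h𝒜.nonempty
  have happ : ∀ p : ℕ × ℕ, ∃ D ∈ 𝒞, (∃ C ∈ 𝒞, μ.real (symmDiff C (a p.1)) < 1 / (p.2 + 1)) →
      μ.real (symmDiff D (a p.1)) < 1 / (p.2 + 1) := by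
    intro p
    by_cases h : ∃ C ∈ 𝒞, μ.real (symmDiff C (a p.1)) < 1 / (p.2 + 1)
    · obtain ⟨C, hC, hCp⟩ := h
      exact ⟨C, hC, fun _ => hCp⟩
    · exact ⟨h𝒞.some, h𝒞.some_mem, fun h' => absurd h' h⟩
  choose g hg𝒞 hg using happ
  refine ⟨fun k => g k.unpair, fun k => hg𝒞 _, fun C hC ε hε => ?_⟩
  obtain ⟨k, hk⟩ := exists_nat_one_div_lt (half_pos hε)
  obtain ⟨t, ht, htC⟩ : ∃ t ∈ 𝒜, μ (symmDiff C t) < ENNReal.ofReal (1 / (k + 1)) :=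
    h𝒜.completion.approx C (hmeas C hC) (by simp) _ (by positivity)
  rw [ENNReal.lt_ofReal_iff_toReal_lt (measure_ne_top _ _)] at htC
  rw [ha] at ht
  obtain ⟨i, rfl⟩ := ht
  have hD := hg (i, k) ⟨C, hC, htC⟩
  refine ⟨Nat.pair i k, ?_⟩
  simp only [Nat.unpair_pair]
  have htri := (measureReal_mono (μ := μ) (symmDiff_triangle (g (i, k)) (a i) C)).trans
    (measureReal_union_le _ _)
  rw [symmDiff_comm (a i) C] at htri
  dsimp only at hD
  change μ.real (symmDiff C (a i)) < _ at htC
  linarith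

/-- There are at most continuum many probability measures on a standard Borel space: they embed in
a set of real functions on `ℚ × ℚ`. -/
theorem exists_injective_probabilityMeasure (Ω : Type*) [MeasurableSpace Ω] [StandardBorelSpace Ω] :
    ∃ f : ProbabilityMeasure Ω → (ℚ × ℚ → ℝ), Function.Injective f := by
  have hf := measurableEmbedding_embeddingReal Ω
  refine ⟨fun μ q => ((μ : Measure Ω).map (embeddingReal Ω)).real (Ioo (q.1 : ℝ) q.2),
    fun μ ν h => ?_⟩
  have hmap : (μ : Measure Ω).map (embeddingReal Ω) = (ν : Measure Ω).map (embeddingReal Ω) := by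
    refine Real.measure_ext_Ioo_rat fun a b => ?_
    have := congrFun h (a, b)
    exact (ENNReal.toReal_eq_toReal_iff' (measure_ne_top _ _) (measure_ne_top _ _)).mp this
  have heq : (μ : Measure Ω) = ν := by
    rw [← hf.comap_map (μ : Measure Ω), hmap, hf.comap_map]
  exact Subtype.ext heq

/-- The well-ordered type whose order type is the initial ordinal of the continuum; its proper
initial segments have fewer than continuum many elements. -/
abbrev ContinuumIndex : Type := Cardinal.continuum.{0}.ord.ToType

theorem mk_Iic_continuumIndex_lt (w : ContinuumIndex) :
    Cardinal.mk (Iic w) < Cardinal.continuum := by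
  have h : Cardinal.mk (Iio w) < Cardinal.continuum := by
    simpa using Cardinal.mk_Iio_lt w
  rw [← Iio_insert]
  refine (Cardinal.mk_insert_le).trans_lt ?_
  exact Cardinal.add_lt_of_lt Cardinal.aleph0_le_continuum h
    (Cardinal.one_lt_aleph0.trans Cardinal.aleph0_lt_continuum)

/-- A subfamily of the class, indexed by the continuum, that is dense for every probability
measure at once. The class itself may have more than continuum many members. -/
theorem exists_dense_continuumIndex {Ω : Type*} [MeasurableSpace Ω] [StandardBorelSpace Ω]
    {𝒞 : Set (Set Ω)} (h𝒞 : 𝒞.Nonempty) (hmeas : ∀ C ∈ 𝒞, UniversallyMeasurable C) :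
    ∃ D : ContinuumIndex → Set Ω, (∀ w, D w ∈ 𝒞) ∧ ∀ μ : ProbabilityMeasure Ω, ∀ C ∈ 𝒞,
      ∀ ε : ℝ, 0 < ε → ∃ w, (μ : Measure Ω).real (symmDiff (D w) C) < ε := by
  classical
  have hseq := fun μ : ProbabilityMeasure Ω =>
    exists_seq_dense_in_measure (μ : Measure Ω) h𝒞 fun C hC => hmeas C hC μ
  choose g hg𝒞 hg using hseq
  obtain ⟨f, hf⟩ := exists_injective_probabilityMeasure Ω
  have hcard : Cardinal.mk ((ℚ × ℚ → ℝ) × ℕ) ≤ Cardinal.mk ContinuumIndex := by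
    rw [Cardinal.mk_ord_toType]
    simp [Cardinal.mk_real]
  obtain ⟨e⟩ := Cardinal.le_def _ _ |>.mp hcard
  let code : ProbabilityMeasure Ω × ℕ → ContinuumIndex := fun p => e (f p.1, p.2)
  have hcode : Function.Injective code := by
    rintro ⟨μ, k⟩ ⟨ν, l⟩ h
    have := Prod.ext_iff.mp (e.injective h)
    exact Prod.ext (hf this.1) this.2
  refine ⟨Function.extend code (fun p => g p.1 p.2) fun _ => h𝒞.some, fun w => ?_,
    fun μ C hC ε hε => ?_⟩
  · by_cases h : ∃ p, code p = w
    · obtain ⟨p, rfl⟩ := h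
      rw [hcode.extend_apply]
      exact hg𝒞 _ _
    · rw [Function.extend_apply' _ _ _ h]
      exact h𝒞.some_mem
  · obtain ⟨k, hk⟩ := hg μ C hC ε hε
    exact ⟨code (μ, k), by rwa [hcode.extend_apply]⟩

end DenseFamily

/-! ### Learning by the first consistent concept -/

section Learning

open Set

variable {Ω : Type*}

theorem labels_eq_labels_iff {C D : Set Ω} {n : ℕ} {σ : Fin n → Ω} :
    labels D σ = labels C σ ↔ ∀ j, σ j ∉ symmDiff D C := by
  simp only [funext_iff, labels, decide_eq_decide, mem_symmDiff]
  exact forall_congr' fun j => by tauto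

open Classical in
/-- The first member of the well-ordered family `D` that is consistent with the labelled sample, or
the default `C₀` if there is none. -/
noncomputable def firstConsistent {W : Type*} [LinearOrder W] [WellFoundedLT W]
    (D : W → Set Ω) (C₀ : Set Ω) {n : ℕ} (σ : Fin n → Ω)
    (τ : Fin n → Bool) : Set Ω :=
  if h : ∃ w, labels (D w) σ = τ then D (wellFounded_lt.min {w | labels (D w) σ = τ} h) else C₀

/-- The samples on which `C` and `D` induce the same labelling. -/
def agreeEvent (C : Set Ω) (n : ℕ) (D : Set Ω) : Set (Fin n → Ω) :=
  {σ | ∀ j, σ j ∉ symmDiff D C}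

/-- The samples labelled by `C` for which `D w` is the first consistent member of the family. -/
def firstEvent {W : Type*} [LinearOrder W]
    (D : W → Set Ω) (C : Set Ω) (n : ℕ) (w : W) : Set (Fin n → Ω) :=
  agreeEvent C n (D w) \ ⋃ v : Iio w, agreeEvent C n (D v)

theorem firstConsistent_of_mem_firstEvent {W : Type*} [LinearOrder W] [WellFoundedLT W]
    {D : W → Set Ω} (C₀ : Set Ω) {C : Set Ω} {n : ℕ} {w : W}
    {σ : Fin n → Ω} (hσ : σ ∈ firstEvent D C n w) :
    firstConsistent D C₀ σ (labels C σ) = D w := by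
  have hw : w ∈ {w | labels (D w) σ = labels C σ} := labels_eq_labels_iff.mpr hσ.1
  have hex : ∃ w, labels (D w) σ = labels C σ := ⟨w, hw⟩
  rw [firstConsistent, dif_pos hex]
  congr 1
  refine le_antisymm (wellFounded_lt.min_le hw) (not_lt.mp fun hlt => hσ.2 ?_)
  exact mem_iUnion.mpr ⟨⟨_, hlt⟩, labels_eq_labels_iff.mp
    (wellFounded_lt.min_mem {w | labels (D w) σ = labels C σ} hex)⟩

theorem exists_le_mem_firstEvent {W : Type*} [LinearOrder W] [WellFoundedLT W]
    {D : W → Set Ω} {C : Set Ω} {n : ℕ} {w : W} {σ : Fin n → Ω}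
    (hσ : σ ∈ agreeEvent C n (D w)) : ∃ v ≤ w, σ ∈ firstEvent D C n v := by
  let S : Set W := {v | σ ∈ agreeEvent C n (D v)}
  have hS : S.Nonempty := ⟨w, hσ⟩
  refine ⟨wellFounded_lt.min S hS, wellFounded_lt.min_le (show w ∈ S from hσ),
    wellFounded_lt.min_mem S hS, ?_⟩
  intro h
  obtain ⟨v, hv⟩ := mem_iUnion.mp h
  exact wellFounded_lt.not_lt_min S hv v.2

variable [MeasurableSpace Ω]

instance (μ : ProbabilityMeasure Ω) (n : ℕ) : IsProbabilityMeasure (samplingMeasure μ n) := by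
  unfold samplingMeasure; infer_instance

theorem nullMeasurableSet_agreeEvent {μ : ProbabilityMeasure Ω} {C D : Set Ω}
    (hC : NullMeasurableSet C (μ : Measure Ω)) (hD : NullMeasurableSet D (μ : Measure Ω)) (n : ℕ) :
    NullMeasurableSet (agreeEvent C n D) (samplingMeasure μ n) := by
  have hCD : NullMeasurableSet (symmDiff D C) (μ : Measure Ω) := hD.symmDiff hC
  have : agreeEvent C n D = ⋂ j, Function.eval j ⁻¹' (symmDiff D C)ᶜ := by
    ext σ; simp only [agreeEvent, mem_iInter]; rfl
  rw [this]
  exact NullMeasurableSet.iInter fun j =>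
    hCD.compl.preimage (Measure.quasiMeasurePreserving_eval (fun _ => (μ : Measure Ω)) j)

theorem measure_compl_agreeEvent_le {μ : ProbabilityMeasure Ω} {C D : Set Ω}
    (hC : NullMeasurableSet C (μ : Measure Ω)) (hD : NullMeasurableSet D (μ : Measure Ω)) (n : ℕ) :
    (samplingMeasure μ n).real (agreeEvent C n D)ᶜ ≤ n * (μ : Measure Ω).real (symmDiff D C) := by
  have hCD : NullMeasurableSet (symmDiff D C) (μ : Measure Ω) := hD.symmDiff hC
  have : (agreeEvent C n D)ᶜ = ⋃ j, Function.eval j ⁻¹' symmDiff D C := by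
    ext σ; simp [agreeEvent, -preimage_symmDiff]
  rw [this]
  refine (measureReal_iUnion_fintype_le _).trans ?_
  have hpre : ∀ j : Fin n, (samplingMeasure μ n).real (Function.eval j ⁻¹' symmDiff D C)
      = (μ : Measure Ω).real (symmDiff D C) := fun j =>
    (measurePreserving_eval (fun _ : Fin n => (μ : Measure Ω)) j).measureReal_preimage hCD
  simp only [hpre, Finset.sum_const, Finset.card_univ, Fintype.card_fin, nsmul_eq_mul, le_refl]

/-- Some `D (w k)` has distance less than `1 / (k + 1)` from `C`, hence disagrees with `C` on an
`n`-sample with probability at most `n / (k + 1)`. -/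
theorem exists_seq_ae_agree {W : Type*} {D : W → Set Ω} {μ : ProbabilityMeasure Ω} {C : Set Ω}
    (hC : NullMeasurableSet C (μ : Measure Ω)) (hD : ∀ w, NullMeasurableSet (D w) (μ : Measure Ω))
    (hdense : ∀ ε : ℝ, 0 < ε → ∃ w, (μ : Measure Ω).real (symmDiff (D w) C) < ε) (n : ℕ) :
    ∃ w : ℕ → W, ∀ᵐ σ ∂samplingMeasure μ n, ∃ k, σ ∈ agreeEvent C n (D (w k)) := by
  choose w hw using fun k : ℕ => hdense (1 / (k + 1)) (by positivity)
  refine ⟨w, ?_⟩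
  rw [ae_iff, ← measureReal_eq_zero_iff]
  refine le_antisymm ?_ measureReal_nonneg
  have hlim : Filter.Tendsto (fun k : ℕ => (n : ℝ) * (1 / (k + 1))) Filter.atTop (nhds 0) := by
    simpa using tendsto_one_div_add_atTop_nhds_zero_nat.const_mul (n : ℝ)
  refine ge_of_tendsto' hlim fun k => ?_
  refine (measureReal_mono fun σ hσ => ?_).trans
    ((measure_compl_agreeEvent_le hC (hD (w k)) n).trans (by gcongr; exact (hw k).le))
  exact fun h => hσ ⟨k, h⟩

variable [StandardBorelSpace Ω]

theorem MartinsAxiom.nullMeasurableSet_firstEvent (hMA : MartinsAxiom)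
    {W : Type} [LinearOrder W] (hW : ∀ w : W, Cardinal.mk (Iic w) < Cardinal.continuum)
    {D : W → Set Ω} {μ : ProbabilityMeasure Ω} {C : Set Ω}
    (hC : NullMeasurableSet C (μ : Measure Ω)) (hD : ∀ w, NullMeasurableSet (D w) (μ : Measure Ω))
    (n : ℕ) (w : W) : NullMeasurableSet (firstEvent D C n w) (samplingMeasure μ n) :=
  (nullMeasurableSet_agreeEvent hC (hD w) n).diff <|
    hMA.nullMeasurableSet_iUnion
      ((Cardinal.mk_le_mk_of_subset Iio_subset_Iic_self).trans_lt (hW w))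
      fun v => nullMeasurableSet_agreeEvent hC (hD v) n

/-- Almost everywhere, the preimage of any set of reals is a countable union of unions, over parts
of proper initial segments, of the events `firstEvent D C n v`. -/
theorem MartinsAxiom.nullMeasurable_error (hMA : MartinsAxiom)
    {W : Type} [LinearOrder W] [WellFoundedLT W]
    (hW : ∀ w : W, Cardinal.mk (Iic w) < Cardinal.continuum)
    {D : W → Set Ω} {μ : ProbabilityMeasure Ω} {C : Set Ω} (C₀ : Set Ω)
    (hC : NullMeasurableSet C (μ : Measure Ω)) (hD : ∀ w, NullMeasurableSet (D w) (μ : Measure Ω))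
    (hdense : ∀ ε : ℝ, 0 < ε → ∃ w, (μ : Measure Ω).real (symmDiff (D w) C) < ε) (n : ℕ) :
    NullMeasurable (fun σ : Fin n → Ω => (μ : Measure Ω).real
      (symmDiff (firstConsistent D C₀ σ (labels C σ)) C)) (samplingMeasure μ n) := by
  intro s _
  obtain ⟨w, hw⟩ := exists_seq_ae_agree hC hD hdense n
  let T : Set W := {v | (μ : Measure Ω).real (symmDiff (D v) C) ∈ s}
  have hE : NullMeasurableSet (⋃ k, ⋃ v : ↥(Iic (w k) ∩ T), firstEvent D C n v)
      (samplingMeasure μ n) :=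
    NullMeasurableSet.iUnion fun k => hMA.nullMeasurableSet_iUnion
      ((Cardinal.mk_le_mk_of_subset inter_subset_left).trans_lt (hW (w k)))
      fun v => hMA.nullMeasurableSet_firstEvent hW hC hD n v
  refine hE.congr ?_
  filter_upwards [hw] with σ hσ
  refine propext ⟨fun h => ?_, fun h => ?_⟩
  · obtain ⟨k, v, hv⟩ := mem_iUnion₂.mp h
    change (μ : Measure Ω).real _ ∈ s
    rw [firstConsistent_of_mem_firstEvent C₀ hv]
    exact v.2.2
  · obtain ⟨k, hk⟩ := hσ
    obtain ⟨v, hvk, hv⟩ := exists_le_mem_firstEvent hk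
    have h : (μ : Measure Ω).real _ ∈ s := h
    rw [firstConsistent_of_mem_firstEvent C₀ hv] at h
    exact mem_iUnion₂.mpr ⟨k, ⟨v, hvk, h⟩, hv⟩

/-- Taking symmetric differences with a fixed set does not increase the VC dimension. -/
theorem card_le_of_symmDiff_shatters {Ω ι : Type*} {𝒞 : Set (Set Ω)} {d : ℕ}
    (hd : ∀ s : Finset Ω, Shatters 𝒞 s → s.card ≤ d) {D : ι → Set Ω} (hD : ∀ i, D i ∈ 𝒞)
    (C : Set Ω) (F : Finset ι) (s : Finset Ω)
    (hs : ∀ t : Set Ω, t ⊆ ↑s → ∃ i ∈ F, symmDiff (D i) C ∩ ↑s = t) : s.card ≤ d := by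
  refine hd s fun t ht => ?_
  obtain ⟨i, -, hi⟩ := hs (symmDiff t C ∩ ↑s) inter_subset_right
  refine ⟨D i, hD i, ?_⟩
  ext x
  have h1 := Set.ext_iff.mp hi x
  have h2 := @ht x
  simp only [mem_inter_iff, mem_symmDiff] at h1 ⊢
  tauto

/-- The error bound for a single target concept and measure; the right-hand side depends on
neither. -/
theorem MartinsAxiom.measure_error_le (hMA : MartinsAxiom)
    {W : Type} [LinearOrder W] [WellFoundedLT W]
    (hW : ∀ w : W, Cardinal.mk (Iic w) < Cardinal.continuum)
    {D : W → Set Ω} {μ : ProbabilityMeasure Ω} {C : Set Ω} (C₀ : Set Ω)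
    (hC : NullMeasurableSet C (μ : Measure Ω)) (hD : ∀ w, NullMeasurableSet (D w) (μ : Measure Ω))
    (hdense : ∀ ε : ℝ, 0 < ε → ∃ w, (μ : Measure Ω).real (symmDiff (D w) C) < ε)
    {𝒞 : Set (Set Ω)} (hD𝒞 : ∀ w, D w ∈ 𝒞) {d : ℕ}
    (hd : ∀ s : Finset Ω, Shatters 𝒞 s → s.card ≤ d) {ε : ℝ} (hε : 0 < ε) {n : ℕ} (hn : 0 < n) :
    samplingMeasure μ n {σ : Fin n → Ω | ε < (μ : Measure Ω).real
        (symmDiff (firstConsistent D C₀ σ (labels C σ)) C)}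
      ≤ ENNReal.ofReal
        (2 / ε * ((∑ l ∈ Finset.Iic d, (2 * n).choose l : ℕ) / 2 ^ ⌈ε / 2 * n⌉₊)) := by
  obtain ⟨w, hw⟩ := exists_seq_ae_agree hC hD hdense n
  let T : Set W := {v | ε < (μ : Measure Ω).real (symmDiff (D v) C)}
  have hA : ∀ v, NullMeasurableSet (agreeEvent C n (D v)) (samplingMeasure μ n) := fun v =>
    nullMeasurableSet_agreeEvent hC (hD v) n
  choose S hSc hS using fun k => hMA.exists_countable_ae_iUnion (samplingMeasure μ n)
    (fun v : ↥(Iic (w k) ∩ T) => agreeEvent C n (D v))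
    ((Cardinal.mk_le_mk_of_subset inter_subset_left).trans_lt (hW (w k))) fun v => hA v
  let R : Set W := ⋃ k, Subtype.val '' S k
  have hRc : R.Countable := countable_iUnion fun k => (hSc k).image _
  have hRT : R ⊆ T := by
    refine iUnion_subset fun k => ?_
    rintro _ ⟨v, -, rfl⟩
    exact v.2.2
  have hle : ∀ᵐ σ ∂samplingMeasure μ n, σ ∈ {σ : Fin n → Ω | ε < (μ : Measure Ω).real
        (symmDiff (firstConsistent D C₀ σ (labels C σ)) C)} →
      σ ∈ ⋃ v ∈ R, agreeEvent C n (D v) := by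
    filter_upwards [hw, ae_all_iff.mpr fun k => (hS k).mem_iff] with σ ⟨k, hk⟩ hSσ hσ
    change ε < _ at hσ
    obtain ⟨v, hvk, hv⟩ := exists_le_mem_firstEvent hk
    rw [firstConsistent_of_mem_firstEvent C₀ hv] at hσ
    obtain ⟨u, hu, hσu⟩ := mem_iUnion₂.mp ((hSσ k).mp (mem_iUnion.mpr ⟨⟨v, hvk, hσ⟩, hv.1⟩))
    exact mem_biUnion (mem_iUnion.mpr ⟨k, mem_image_of_mem _ hu⟩) hσu
  refine (measure_mono_ae hle).trans (measure_biUnion_le_of_forall_finset hRc fun F hF => ?_)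
  exact measure_disjoint_sample_le (μ : Measure Ω) (H := fun v => symmDiff (D v) C)
    (fun v _ => (hD v).symmDiff hC) (fun s hs => card_le_of_symmDiff_shatters hd hD𝒞 C F s hs) hε
    (fun v hv => (hRT (hF hv)).le) hn

theorem distributionFreePACLearnable_of_card_le (hMA : MartinsAxiom) {𝒞 : Set (Set Ω)}
    (h𝒞 : 𝒞.Nonempty) (hmeas : ∀ C ∈ 𝒞, UniversallyMeasurable C) {d : ℕ}
    (hd : ∀ s : Finset Ω, Shatters 𝒞 s → s.card ≤ d) : DistributionFreePACLearnable 𝒞 := by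
  obtain ⟨D, hD, hdense⟩ := exists_dense_continuumIndex h𝒞 hmeas
  refine ⟨⟨fun {n} σ τ => firstConsistent D h𝒞.some σ τ, fun {n} σ τ => ?_,
    fun C hC n μ _ => ?_⟩, ?_⟩
  · unfold firstConsistent
    split_ifs
    · exact hD _
    · exact h𝒞.some_mem
  · exact hMA.nullMeasurable_error mk_Iic_continuumIndex_lt _ (hmeas C hC μ)
      (fun w => hmeas _ (hD w) μ) (hdense μ C hC) n
  · intro ε hε δ hδ
    obtain ⟨N, hN⟩ := Filter.eventually_atTop.mp
      ((tendsto_sum_choose_div_two_pow d hε).eventually_le_const hδ)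
    refine ⟨max N 1, fun n hn C hC μ _ => ?_⟩
    have h := hMA.measure_error_le mk_Iic_continuumIndex_lt h𝒞.some (hmeas C hC μ)
      (fun w => hmeas _ (hD w) μ) (hdense μ C hC) hD hd hε (le_of_max_le_right hn)
    exact (ENNReal.toReal_le_of_le_ofReal (by positivity) h).trans (hN n (le_of_max_le_left hn))

end Learning

/-! ### Necessity of finite VC dimension -/

section NoFreeLunch

open Finset

variable {Ω : Type*}

theorem vcDim_lt_top_iff {𝒞 : Set (Set Ω)} :
    vcDim 𝒞 < ⊤ ↔ ∃ d : ℕ, ∀ s : Finset Ω, Shatters 𝒞 s → s.card ≤ d := by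
  constructor
  · intro h
    obtain ⟨d, hd⟩ := ENat.ne_top_iff_exists.mp h.ne
    refine ⟨d, fun s hs => ?_⟩
    have : (s.card : ℕ∞) ≤ vcDim 𝒞 := le_iSup₂ (f := fun s (_ : Shatters 𝒞 s) => (s.card : ℕ∞)) s hs
    rw [← hd] at this
    exact_mod_cast this
  · rintro ⟨d, hd⟩
    refine lt_of_le_of_lt (iSup₂_le fun s hs => ?_) (ENat.natCast_lt_top d)
    exact_mod_cast hd s hs

theorem Shatters.mono {𝒞 : Set (Set Ω)} {s t : Finset Ω} (hs : Shatters 𝒞 s) (hts : t ⊆ s) :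
    Shatters 𝒞 t := by
  intro u hu
  obtain ⟨C, hC, hCs⟩ := hs u (hu.trans (coe_subset.mpr hts))
  refine ⟨C, hC, Set.ext fun x => ?_⟩
  have h1 := Set.ext_iff.mp hCs x
  have h2 := @hu x
  have h3 := @hts x
  simp only [Set.mem_inter_iff, mem_coe] at *
  tauto

open Classical in
/-- For a sample inside `s`, flipping the label of an unseen point changes the target but not the
labelled sample, so a rule errs at each of the at least `n` unseen points for half of the targets.
-/
theorem sum_card_error_ge {s : Finset Ω} (C : Finset Ω → Set Ω)
    (hC : ∀ t ∈ s.powerset, C t ∩ ↑s = ↑t) {n : ℕ} (hs : s.card = 2 * n)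
    (L : (Fin n → Bool) → Set Ω) {σ : Fin n → Ω} (hσ : ∀ j, σ j ∈ s) :
    2 ^ (2 * n) * n ≤ 2 * ∑ t ∈ s.powerset,
      (s.filter fun x => x ∈ symmDiff (L (labels (C t) σ)) (C t)).card := by
  have hmem : ∀ t ∈ s.powerset, ∀ x ∈ s, (x ∈ C t ↔ x ∈ t) := by
    intro t ht x hx
    have := Set.ext_iff.mp (hC t ht) x
    simpa [hx] using this
  have hunseen : ∀ x ∈ s \ univ.image σ, 2 * ∑ t ∈ s.powerset,
      (if x ∈ symmDiff (L (labels (C t) σ)) (C t) then 1 else 0) = 2 ^ (2 * n) := by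
    intro x hx
    obtain ⟨hxs, hxσ⟩ := mem_sdiff.mp hx
    have hflip : ∀ t ∈ s.powerset, symmDiff t {x} ∈ s.powerset := by
      intro t ht
      rw [mem_powerset] at ht ⊢
      intro y hy
      rcases mem_symmDiff.mp hy with h | h
      · exact ht h.1
      · exact (mem_singleton.mp h.1) ▸ hxs
    have hlabels : ∀ t ∈ s.powerset, labels (C (symmDiff t {x})) σ = labels (C t) σ := by
      intro t ht
      funext j
      have hne : σ j ≠ x := fun h => hxσ (mem_image.mpr ⟨j, mem_univ _, h⟩)
      simp only [labels, hmem _ ht _ (hσ j), hmem _ (hflip t ht) _ (hσ j), mem_symmDiff,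
        mem_singleton, hne]
      simp
    have hsum : ∑ t ∈ s.powerset, (if x ∈ symmDiff (L (labels (C t) σ)) (C t) then 1 else 0)
        = ∑ t ∈ s.powerset, (if x ∈ symmDiff (L (labels (C (symmDiff t {x})) σ))
          (C (symmDiff t {x})) then 1 else 0) := by
      refine sum_nbij' (fun t => symmDiff t {x}) (fun t => symmDiff t {x}) hflip hflip
        (fun t _ => by simp) (fun t _ => by simp) fun t _ => by simp
    rw [two_mul]
    nth_rewrite 2 [hsum]
    rw [← sum_add_distrib]
    rw [sum_congr rfl (g := fun _ => 1)]
    · simp [hs]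
    intro t ht
    rw [hlabels t ht]
    have h1 := hmem t ht x hxs
    have h2 := hmem _ (hflip t ht) x hxs
    simp only [mem_symmDiff, mem_singleton] at h2
    simp only [Set.mem_symmDiff, h1, h2]
    by_cases ha : x ∈ L (labels (C t) σ) <;> by_cases hb : x ∈ t <;> simp [ha, hb]
  have hcard : n ≤ (s \ univ.image σ).card := by
    have h1 := le_card_sdiff (univ.image σ) s
    have h2 : (univ.image σ).card ≤ n := card_image_le.trans_eq (by simp)
    omega
  calc 2 ^ (2 * n) * n ≤ ∑ x ∈ s \ univ.image σ, 2 ^ (2 * n) := by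
        rw [sum_const, smul_eq_mul, mul_comm]
        exact Nat.mul_le_mul_right _ hcard
    _ = ∑ x ∈ s \ univ.image σ, 2 * ∑ t ∈ s.powerset,
          (if x ∈ symmDiff (L (labels (C t) σ)) (C t) then 1 else 0) :=
        sum_congr rfl fun x hx => (hunseen x hx).symm
    _ ≤ ∑ x ∈ s, 2 * ∑ t ∈ s.powerset,
          (if x ∈ symmDiff (L (labels (C t) σ)) (C t) then 1 else 0) :=
        sum_le_sum_of_subset sdiff_subset
    _ = _ := by
        rw [← mul_sum, sum_comm]
        simp only [card_filter]

variable [MeasurableSpace Ω]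

/-- The uniform distribution on a finite set, a sum of Dirac masses. It is the zero measure when `s`
is empty. -/
noncomputable def uniformMeasure (s : Finset Ω) : Measure Ω :=
  (s.card : ENNReal)⁻¹ • ∑ x ∈ s, Measure.dirac x

open Classical in
theorem uniformMeasure_real [MeasurableSingletonClass Ω] (s : Finset Ω) (A : Set Ω) :
    (uniformMeasure s).real A = (s.filter fun x => x ∈ A).card / s.card := by
  have : uniformMeasure s A = (s.card : ENNReal)⁻¹ * (s.filter fun x => x ∈ A).card := by
    simp [uniformMeasure, Measure.finsetSum_apply, Set.indicator_apply]
  rw [measureReal_def, this, ENNReal.toReal_mul, ENNReal.toReal_inv, div_eq_inv_mul]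
  simp

theorem isProbabilityMeasure_uniformMeasure {s : Finset Ω} (hs : s.Nonempty) :
    IsProbabilityMeasure (uniformMeasure s) := by
  refine ⟨?_⟩
  simp only [uniformMeasure, Measure.smul_apply, Measure.finsetSum_apply, measure_univ, sum_const,
    smul_eq_mul, nsmul_eq_mul, mul_one]
  exact ENNReal.inv_mul_cancel (by simpa using hs.ne_empty) (by simp)

/-- Averaged over the targets cut out of a shattered set of `2 * n` points, the expected error is
at least `1 / 4`, whereas the hypothesis bounds it by `1 / 8 + 1 / 16` for every target. -/
theorem card_lt_of_isPAC [MeasurableSingletonClass Ω] {𝒞 : Set (Set Ω)}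
    (L : LearningRule 𝒞 Set.univ) {n : ℕ} (hn : 0 < n)
    (hL : ∀ C ∈ 𝒞, ∀ μ : ProbabilityMeasure Ω, (samplingMeasure μ n).real
      {σ : Fin n → Ω | 1 / 8 < (μ : Measure Ω).real (symmDiff (L.rule σ (labels C σ)) C)} ≤ 1 / 16)
    {s : Finset Ω} (hs : Shatters 𝒞 s) : s.card < 2 * n := by
  classical
  by_contra! hcard
  obtain ⟨s, hss, hsn⟩ := exists_subset_card_eq hcard
  have hs := hs.mono hss
  have hsne : s.Nonempty := card_pos.mp (by omega)
  let μ : ProbabilityMeasure Ω := ⟨uniformMeasure s, isProbabilityMeasure_uniformMeasure hsne⟩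
  have hμ : ∀ A : Set Ω, (μ : Measure Ω).real A = (s.filter fun x => x ∈ A).card / (2 * n) := by
    intro A
    have := uniformMeasure_real s A
    rw [hsn] at this
    push_cast at this
    exact this
  set ν := samplingMeasure μ n
  choose! C hC𝒞 hC using fun (t : Finset Ω) (ht : t ∈ s.powerset) =>
    hs t (coe_subset.mpr (mem_powerset.mp ht))
  let err : Finset Ω → (Fin n → Ω) → ℝ := fun t σ =>
    (μ : Measure Ω).real (symmDiff (L.rule σ (labels (C t) σ)) (C t))
  have hsupp : ∀ᵐ σ ∂ν, ∀ j, σ j ∈ s := by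
    refine ae_all_iff.mpr fun j => ?_
    have h0 : ∀ᵐ x ∂(μ : Measure Ω), x ∈ s := by
      rw [ae_iff, ← measureReal_eq_zero_iff, hμ]
      simp
    exact (Measure.quasiMeasurePreserving_eval (fun _ => (μ : Measure Ω)) j).ae h0
  have hmeas : ∀ t ∈ s.powerset, NullMeasurable (err t) ν := fun t ht =>
    L.measurable_error (C t) (hC𝒞 t ht) n μ (Set.mem_univ _)
  have hint : ∀ t ∈ s.powerset, Integrable (err t) ν := fun t ht =>
    Integrable.of_bound (hmeas t ht).aemeasurable.aestronglyMeasurable 1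
      (Filter.Eventually.of_forall fun σ => by
        rw [Real.norm_of_nonneg measureReal_nonneg]; exact measureReal_le_one)
  have hlow : (2 : ℝ) ^ (2 * n) / 4 ≤ ∑ t ∈ s.powerset, ∫ σ, err t σ ∂ν := by
    rw [← integral_finsetSum _ hint]
    have hconst : (2 : ℝ) ^ (2 * n) / 4 = ∫ _, (2 : ℝ) ^ (2 * n) / 4 ∂ν := by simp
    rw [hconst]
    refine integral_mono_ae (integrable_const _) (integrable_finsetSum _ hint) ?_
    filter_upwards [hsupp] with σ hσ
    have h := sum_card_error_ge C hC hsn (L.rule σ) hσ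
    have h' : (2 : ℝ) ^ (2 * n) * n ≤ 2 * ∑ t ∈ s.powerset,
      ((s.filter fun x => x ∈ symmDiff (L.rule σ (labels (C t) σ)) (C t)).card : ℝ) := by
      exact_mod_cast h
    simp only [err, hμ]
    rw [← sum_div, le_div_iff₀ (by positivity)]
    linarith
  have hup : ∀ t ∈ s.powerset, ∫ σ, err t σ ∂ν ≤ 3 / 16 := by
    intro t ht
    let E : Set (Fin n → Ω) := {σ | 1 / 8 < err t σ}
    have hE : NullMeasurableSet E ν := hmeas t ht measurableSet_Ioi
    have hEi : Integrable (E.indicator fun _ => (1 : ℝ)) ν := (integrable_const 1).indicator₀ hE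
    have hle : ∀ σ, err t σ ≤ E.indicator (fun _ => (1 : ℝ)) σ + 1 / 8 := by
      intro σ
      by_cases hσ : σ ∈ E
      · rw [Set.indicator_of_mem hσ]
        have : err t σ ≤ 1 := measureReal_le_one
        linarith
      · rw [Set.indicator_of_notMem hσ, zero_add]
        exact not_lt.mp hσ
    have h := integral_mono (hint t ht) (hEi.add (integrable_const (1 / 8))) hle
    rw [integral_add' hEi (integrable_const _), integral_indicator₀ hE, integral_const,
      integral_const] at h
    have hb : ν.real E ≤ 1 / 16 := hL (C t) (hC𝒞 t ht) μ
    simp only [probReal_univ, smul_eq_mul, mul_one, one_mul, measureReal_restrict_apply_univ] at h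
    linarith
  have hsum := hlow.trans (sum_le_sum hup)
  rw [sum_const, card_powerset, hsn, nsmul_eq_mul] at hsum
  push_cast at hsum
  have : (0 : ℝ) < 2 ^ (2 * n) := by positivity
  linarith

theorem exists_card_le_of_distributionFreePACLearnable [MeasurableSingletonClass Ω]
    {𝒞 : Set (Set Ω)} (h : DistributionFreePACLearnable 𝒞) :
    ∃ d : ℕ, ∀ s : Finset Ω, Shatters 𝒞 s → s.card ≤ d := by
  obtain ⟨L, hL⟩ := h
  obtain ⟨N, hN⟩ := hL (1 / 8) (by norm_num) (1 / 16) (by norm_num)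
  refine ⟨2 * (N + 1), fun s hs => (card_lt_of_isPAC L N.succ_pos (fun C hC μ => ?_) hs).le⟩
  exact hN _ (Nat.le_succ N) C hC μ (Set.mem_univ _)

end NoFreeLunch
end PACLearning

theorem theorem2 (hMA : PACLearning.MartinsAxiom)
    {Ω : Type*} [MeasurableSpace Ω] [StandardBorelSpace Ω]
    (𝒞 : Set (Set Ω)) (h𝒞 : 𝒞.Nonempty)
    (hmeas : ∀ C ∈ 𝒞, PACLearning.UniversallyMeasurable C) :
    PACLearning.DistributionFreePACLearnable 𝒞 ↔ PACLearning.vcDim 𝒞 < ⊤ := by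
  rw [PACLearning.vcDim_lt_top_iff]
  exact ⟨PACLearning.exists_card_le_of_distributionFreePACLearnable,
    fun ⟨_, hd⟩ => PACLearning.distributionFreePACLearnable_of_card_le hMA h𝒞 hmeas hd⟩
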